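/- Let $q$ be a prime power, $m\ge 2$, let $U$ and $W$ be vector spaces over $\mathbb{F}_q$ of dimensions $2$ and $m$, and let $V:=U\otimes W$. Let $\mathcal{L}$ be either $$\{(U\otimes w)+v : w\in W\setminus\{0\},\ v\in V\}\quad\text{or}\quad \{(u\otimes W)+v : u\in U\setminus\{0\},\ v\in V\},$$ where $U\otimes w=\{u\otimes w:u\in U\}$ and $u\otimes W=\{u\otimes w:w\in W\}$. Then $\mathcal{S}:=(V,\mathcal{L})$ is a partial linear space (every line has at least two points, and any two distinct points lie on at most one line), and its full automorphism group $\mathrm{Aut}(\mathcal{S})$, consisting of all permutations of $V$ that preserve $\mathcal{L}$, is $$\mathrm{Aut}(\mathcal{S})=V{:}\bigl((\mathrm{GL}(U)\otimes \mathrm{GL}(W)){:}\mathrm{Aut}(\mathbb{F}_q)\bigr)\;\simeq\; V{:}\bigl((\mathrm{GL}_2(q)\circ \mathrm{GL}_m(q)){:}\mathrm{Aut}(\mathbb{F}_q)\bigr).$$ In the first group, $V$ is the group of all translations of $V$; $\mathrm{GL}(U)\otimes\mathrm{GL}(W)$ is the group of all maps $g\otimes h$ with $g\in\mathrm{GL}(U)$,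 $h\in\mathrm{GL}(W)$; $\mathrm{Aut}(\mathbb{F}_q)$ acts on $U$ and on $W$ coordinatewise with respect to any fixed bases, and on $V$ by $(u\otimes w)^\sigma=u^\sigma\otimes w^\sigma$; and $N{:}H$ denotes the (internal) semidirect product of a normal subgroup $N$ by a subgroup $H$. In the second group, $\mathrm{GL}_2(q)\circ\mathrm{GL}_m(q)$ is the central product $(\mathrm{GL}_2(q)\times\mathrm{GL}_m(q))/\{(\lambda I,\lambda^{-1}I):\lambda\in\mathbb{F}_q^*\}$, and the (external) semidirect products are formed with respect to the entrywise action of $\mathrm{Aut}(\mathbb{F}_q)$ on matrices and the actions on $V=U\otimes W$ of matrices (via the chosen bases) and of $\mathrm{Aut}(\mathbb{F}_q)$. -/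

import Mathlib

open scoped TensorProduct

namespace TensorPLS

/-! ### Partial linear spaces and their automorphisms -/

/-- `(P, lines)` is a partial linear space: every line contains at least two points, and
any two distinct points are contained in at most one line. -/
structure IsPartialLinearSpace {P : Type*} (lines : Set (Set P)) : Prop where
  nonempty : Nonempty P
  two_points : ∀ L ∈ lines, L.Nontrivial
  unique_line : ∀ L ∈ lines, ∀ M ∈ lines, ∀ x y : P, x ≠ y →
    x ∈ L → y ∈ L → x ∈ M → y ∈ M → L = M

/-- The full automorphism group of the incidence structure `(P, lines)`: all permutations of the
point set `P` that preserve the set of lines. -/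
def autGroup {P : Type*} (lines : Set (Set P)) : Subgroup (Equiv.Perm P) where
  carrier := {g | ∀ L : Set P, g '' L ∈ lines ↔ L ∈ lines}
  one_mem' := by
    intro L
    simp
  mul_mem' := by
    intro g h hg hh L
    rw [← hh L, ← hg (h '' L), ← Set.image_comp]
    rfl
  inv_mem' := by
    intro g hg L
    rw [← hg ((g⁻¹ : Equiv.Perm P) '' L), ← Set.image_comp, ← Equiv.Perm.coe_mul]
    simp

/-- `G = N : H`, the subgroup `G` is the internal split extension (semidirect product) of its
normal subgroup `N` by its subgroup `H`. -/
structure IsSplitExtension {X : Type*} [Group X] (G N H : Subgroup X) : Prop where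
  left_le : N ≤ G
  right_le : H ≤ G
  normal : (N.subgroupOf G).Normal
  inf_eq : N ⊓ H = ⊥
  sup_eq : N ⊔ H = G

variable {F U W : Type*} [Field F] [AddCommGroup U] [Module F U] [AddCommGroup W] [Module F W]

/-! ### The two line sets on `U ⊗ W` -/

variable (F U W) in
/-- The translates `(U ⊗ w) + v` with `w ∈ W`, `w ≠ 0` and `v ∈ U ⊗ W`. -/
def linesU : Set (Set (U ⊗[F] W)) :=
  {L | ∃ w : W, w ≠ 0 ∧ ∃ v : U ⊗[F] W, L = {x | ∃ u : U, x = u ⊗ₜ[F] w + v}}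

variable (F U W) in
/-- The translates `(u ⊗ W) + v` with `u ∈ U`, `u ≠ 0` and `v ∈ U ⊗ W`. -/
def linesW : Set (Set (U ⊗[F] W)) :=
  {L | ∃ u : U, u ≠ 0 ∧ ∃ v : U ⊗[F] W, L = {x | ∃ w : W, x = u ⊗ₜ[F] w + v}}

/-! ### The subgroups `V`, `GL(U) ⊗ GL(W)` and `Aut(F)` of `Sym(V)`, where `V = U ⊗ W` -/

/-- The group of all translations `x ↦ x + v` of an additive group. -/
def translations (V : Type*) [AddCommGroup V] : Subgroup (Equiv.Perm V) where
  carrier := {g | ∃ v : V, ∀ x : V, g x = x + v}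
  one_mem' := ⟨0, fun x => by simp⟩
  mul_mem' := by
    rintro g h ⟨v, hv⟩ ⟨w, hw⟩
    exact ⟨w + v, fun x => by rw [Equiv.Perm.mul_apply, hv, hw, add_assoc]⟩
  inv_mem' := by
    rintro g ⟨v, hv⟩
    exact ⟨-v, fun x => by rw [Equiv.Perm.inv_eq_iff_eq, hv]; simp⟩

variable (F U W) in
/-- The action of `GL(U) × GL(W)` on `U ⊗ W`, where `(g, h)` acts as `g ⊗ h`, that is,
`u ⊗ w ↦ g u ⊗ h w`. -/
def tensorHom : (U ≃ₗ[F] U) × (W ≃ₗ[F] W) →* (U ⊗[F] W ≃ₗ[F] U ⊗[F] W) where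
  toFun g := TensorProduct.congr g.1 g.2
  map_one' := by
    ext x
    induction x using TensorProduct.induction_on with
    | zero => simp
    | tmul u w => simp
    | add x y hx hy => rw [map_add, map_add, hx, hy]
  map_mul' := by
    intro g h
    ext x
    induction x using TensorProduct.induction_on with
    | zero => simp
    | tmul u w => simp
    | add x y hx hy => rw [map_add, map_add, hx, hy]

variable (F U W) in
/-- `GL(U) ⊗ GL(W) = {g ⊗ h : g ∈ GL(U), h ∈ GL(W)}` as a group of permutations of `U ⊗ W`. -/
def tensorGL : Subgroup (Equiv.Perm (U ⊗[F] W)) where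
  carrier := {g | ∃ a : (U ≃ₗ[F] U) × (W ≃ₗ[F] W), ∀ x, g x = tensorHom F U W a x}
  one_mem' := ⟨1, fun x => by simp⟩
  mul_mem' := by
    rintro g h ⟨a, ha⟩ ⟨b, hb⟩
    exact ⟨a * b, fun x => by rw [Equiv.Perm.mul_apply, ha, hb, map_mul]; rfl⟩
  inv_mem' := by
    rintro g ⟨a, ha⟩
    refine ⟨a⁻¹, fun x => ?_⟩
    rw [Equiv.Perm.inv_eq_iff_eq, ha, ← LinearEquiv.mul_apply, ← map_mul]
    simp

/-- The action of a field automorphism `σ` on a vector space with respect to the basis `b`: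
`(∑ i, c i • b i) ^ σ = ∑ i, σ (c i) • b i`. -/
noncomputable def coordAut {ι M : Type*} [Finite ι] [AddCommGroup M] [Module F M]
    (b : Module.Basis ι F M) (σ : F ≃+* F) : M →ₛₗ[(σ : F →+* F)] M where
  toFun x := b.equivFun.symm fun i => σ (b.equivFun x i)
  map_add' x y := by
    rw [← map_add]
    congr 1
    ext i
    simp
  map_smul' c x := by
    rw [← map_smul]
    congr 1
    ext i
    simp

section

variable {ι κ : Type*} [Finite ι] [Finite κ]
  (bU : Module.Basis ι F U) (bW : Module.Basis κ F W)

/-- The action of a field automorphism `σ` on `U ⊗ W`: `(u ⊗ w) ^ σ = u ^ σ ⊗ w ^ σ`. -/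
noncomputable def tensorAut (σ : F ≃+* F) : U ⊗[F] W →ₛₗ[(σ : F →+* F)] U ⊗[F] W :=
  TensorProduct.map (coordAut bU σ) (coordAut bW σ)

theorem coordAut_one {ι M : Type*} [Finite ι] [AddCommGroup M] [Module F M]
    (b : Module.Basis ι F M) (x : M) : coordAut b (1 : F ≃+* F) x = x := by
  change b.equivFun.symm (b.equivFun x) = x
  exact b.equivFun.symm_apply_apply x

theorem coordAut_mul {ι M : Type*} [Finite ι] [AddCommGroup M] [Module F M]
    (b : Module.Basis ι F M) (σ τ : F ≃+* F) (x : M) :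
    coordAut b (σ * τ) x = coordAut b σ (coordAut b τ x) := by
  change b.equivFun.symm (fun i => σ (τ (b.equivFun x i))) =
    b.equivFun.symm (fun i => σ (b.equivFun (b.equivFun.symm fun j => τ (b.equivFun x j)) i))
  simp

theorem tensorAut_tmul (σ : F ≃+* F) (u : U) (w : W) :
    tensorAut bU bW σ (u ⊗ₜ[F] w) = coordAut bU σ u ⊗ₜ[F] coordAut bW σ w := rfl

theorem tensorAut_one (x : U ⊗[F] W) : tensorAut bU bW (1 : F ≃+* F) x = x := by
  induction x using TensorProduct.induction_on with
  | zero => simp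
  | tmul u w => rw [tensorAut_tmul, coordAut_one, coordAut_one]
  | add x y hx hy => rw [map_add, hx, hy]

theorem tensorAut_mul (σ τ : F ≃+* F) (x : U ⊗[F] W) :
    tensorAut bU bW (σ * τ) x = tensorAut bU bW σ (tensorAut bU bW τ x) := by
  induction x using TensorProduct.induction_on with
  | zero => simp
  | tmul u w => simp only [tensorAut_tmul, coordAut_mul]
  | add x y hx hy => rw [map_add, map_add, map_add, hx, hy]

/-- The group `Aut(F)` acting on `U ⊗ W`, as a group of permutations of `U ⊗ W`. -/
def fieldAuts : Subgroup (Equiv.Perm (U ⊗[F] W)) where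
  carrier := {g | ∃ σ : F ≃+* F, ∀ x, g x = tensorAut bU bW σ x}
  one_mem' := ⟨1, fun x => by rw [tensorAut_one]; rfl⟩
  mul_mem' := by
    rintro g h ⟨σ, hσ⟩ ⟨τ, hτ⟩
    exact ⟨σ * τ, fun x => by rw [Equiv.Perm.mul_apply, hσ, hτ, tensorAut_mul]⟩
  inv_mem' := by
    rintro g ⟨σ, hσ⟩
    refine ⟨σ⁻¹, fun x => ?_⟩
    rw [Equiv.Perm.inv_eq_iff_eq, hσ, ← tensorAut_mul, mul_inv_cancel, tensorAut_one]

end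

/-! ### The abstract group `V : ((GL_n(F) ∘ GL_m(F)) : Aut(F))`, where `V = U ⊗ W` -/

section

variable (F) (n m : ℕ)

/-- The subgroup `{(c, c⁻¹) : c ∈ Fˣ}` of `GL_n(F) × GL_m(F)`, where `c` is written for the scalar
matrix with diagonal entries `c`. -/
def antiScalars : Subgroup (GL (Fin n) F × GL (Fin m) F) where
  carrier := {a | ∃ c : Fˣ, a = (Matrix.GeneralLinearGroup.scalar (Fin n) c,
    Matrix.GeneralLinearGroup.scalar (Fin m) c⁻¹)}
  one_mem' := ⟨1, by rw [inv_one, map_one, map_one]; rfl⟩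
  mul_mem' := by
    rintro _ _ ⟨c, rfl⟩ ⟨d, rfl⟩
    exact ⟨c * d, by rw [Prod.mk_mul_mk, ← map_mul, ← map_mul, ← mul_inv]⟩
  inv_mem' := by
    rintro _ ⟨c, rfl⟩
    exact ⟨c⁻¹, by rw [Prod.inv_mk, ← map_inv, ← map_inv]⟩

theorem scalar_mem_center (k : ℕ) (c : Fˣ) :
    Matrix.GeneralLinearGroup.scalar (Fin k) c ∈ Subgroup.center (GL (Fin k) F) := by
  rw [Matrix.GeneralLinearGroup.center_eq_range_scalar]
  exact ⟨c, rfl⟩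

instance : (antiScalars F n m).Normal where
  conj_mem := by
    rintro _ ⟨c, rfl⟩ ⟨A, B⟩
    refine ⟨c, ?_⟩
    rw [Prod.inv_mk, Prod.mk_mul_mk, Prod.mk_mul_mk,
      Subgroup.mem_center_iff.mp (scalar_mem_center F n c) A,
      Subgroup.mem_center_iff.mp (scalar_mem_center F m c⁻¹) B,
      mul_inv_cancel_right, mul_inv_cancel_right]

/-- The central product `GL_n(F) ∘ GL_m(F)`, with respect to the common central subgroup `Fˣ`
of scalar matrices. -/
abbrev CentralProduct : Type _ := (GL (Fin n) F × GL (Fin m) F) ⧸ antiScalars F n m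

variable {F n m}

/-- A field automorphism acting on pairs of matrices, entry by entry. -/
def pairMap (σ : F ≃+* F) : GL (Fin n) F × GL (Fin m) F →* GL (Fin n) F × GL (Fin m) F :=
  (Matrix.GeneralLinearGroup.map (σ : F →+* F)).prodMap
    (Matrix.GeneralLinearGroup.map (σ : F →+* F))

theorem antiScalars_le_comap (σ : F ≃+* F) :
    antiScalars F n m ≤ (antiScalars F n m).comap (pairMap σ) := by
  rintro _ ⟨c, rfl⟩
  refine ⟨Units.map (σ : F →* F) c, ?_⟩
  refine Prod.ext ?_ ?_
  · exact Matrix.GeneralLinearGroup.map_scalar _ _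
  · exact (Matrix.GeneralLinearGroup.map_scalar _ _).trans (by rw [map_inv]; rfl)

/-- A field automorphism acting on `GL_n(F) ∘ GL_m(F)`. -/
def centralMap (σ : F ≃+* F) : CentralProduct F n m →* CentralProduct F n m :=
  QuotientGroup.map _ _ (pairMap σ) (antiScalars_le_comap σ)

theorem centralMap_one (x : CentralProduct F n m) : centralMap (1 : F ≃+* F) x = x := by
  induction x using QuotientGroup.induction_on with
  | H a => rfl

theorem centralMap_mul (σ τ : F ≃+* F) (x : CentralProduct F n m) :
    centralMap (σ * τ) x = centralMap σ (centralMap τ x) := by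
  induction x using QuotientGroup.induction_on with
  | H a => rfl

variable (F n m) in
/-- The action of `Aut(F)` on `GL_n(F) ∘ GL_m(F)` by automorphisms, `[A, B] ↦ [A ^ σ, B ^ σ]`. -/
def centralAction : (F ≃+* F) →* MulAut (CentralProduct F n m) where
  toFun σ :=
    { toFun := centralMap σ
      invFun := centralMap σ⁻¹
      left_inv := fun x => by rw [← centralMap_mul, inv_mul_cancel, centralMap_one]
      right_inv := fun x => by rw [← centralMap_mul, mul_inv_cancel, centralMap_one]
      map_mul' := map_mul _ }
  map_one' := MulEquiv.ext centralMap_one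
  map_mul' σ τ := MulEquiv.ext (centralMap_mul σ τ)

/-- A group acting on `V` by additive maps acts on it by automorphisms of its additive group. -/
def autOfEnd {G V : Type*} [Group G] [AddCommGroup V] (f : G →* AddMonoid.End V) :
    G →* MulAut (Multiplicative V) where
  toFun g :=
    { toFun := fun x => Multiplicative.ofAdd (f g x.toAdd)
      invFun := fun x => Multiplicative.ofAdd (f g⁻¹ x.toAdd)
      left_inv := fun x => by
        change Multiplicative.ofAdd ((f g⁻¹ * f g) x.toAdd) = x
        rw [← map_mul, inv_mul_cancel, map_one]; rfl
      right_inv := fun x => by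
        change Multiplicative.ofAdd ((f g * f g⁻¹) x.toAdd) = x
        rw [← map_mul, mul_inv_cancel, map_one]; rfl
      map_mul' := fun x y => by rw [toAdd_mul, map_add, ofAdd_add] }
  map_one' := MulEquiv.ext fun x => by
    change Multiplicative.ofAdd (f 1 x.toAdd) = x
    rw [map_one]; rfl
  map_mul' g h := MulEquiv.ext fun x => by
    change Multiplicative.ofAdd (f (g * h) x.toAdd) = Multiplicative.ofAdd ((f g * f h) x.toAdd)
    rw [map_mul]

variable (bU : Module.Basis (Fin n) F U) (bW : Module.Basis (Fin m) F W)

/-- The pair `(A, B)` of matrices acts on `U ⊗ W` by `u ⊗ w ↦ A u ⊗ B w`, in the given bases. -/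
noncomputable def matrixEnd : GL (Fin n) F × GL (Fin m) F →* AddMonoid.End (U ⊗[F] W) where
  toFun a := (TensorProduct.map (Matrix.toLin bU bU a.1.val)
    (Matrix.toLin bW bW a.2.val)).toAddMonoidHom
  map_one' := by
    ext x
    simp only [Prod.fst_one, Prod.snd_one, Units.val_one, Matrix.toLin_one, TensorProduct.map_id]
    rfl
  map_mul' a b := by
    ext x
    simp only [Prod.fst_mul, Prod.snd_mul, Units.val_mul, Matrix.toLin_mul bU bU bU,
      Matrix.toLin_mul bW bW bW, TensorProduct.map_comp]
    rfl

theorem matrixEnd_tmul (a : GL (Fin n) F × GL (Fin m) F) (u : U) (w : W) :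
    matrixEnd bU bW a (u ⊗ₜ[F] w) =
      Matrix.toLin bU bU a.1.val u ⊗ₜ[F] Matrix.toLin bW bW a.2.val w := rfl

theorem toLin_scalar {k : ℕ} {M : Type*} [AddCommGroup M] [Module F M]
    (b : Module.Basis (Fin k) F M) (c : Fˣ) (x : M) :
    Matrix.toLin b b (Matrix.GeneralLinearGroup.scalar (Fin k) c).val x = (c : F) • x := by
  have h : (Matrix.GeneralLinearGroup.scalar (Fin k) c).val =
      (c : F) • (1 : Matrix (Fin k) (Fin k) F) := by
    rw [Matrix.smul_one_eq_diagonal]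
    rfl
  rw [h, map_smul, Matrix.toLin_one]
  rfl

/-- The action of `Aut(F)` on `U ⊗ W`. -/
noncomputable def fieldEnd : (F ≃+* F) →* AddMonoid.End (U ⊗[F] W) where
  toFun σ := (tensorAut bU bW σ).toAddMonoidHom
  map_one' := AddMonoidHom.ext (tensorAut_one bU bW)
  map_mul' σ τ := AddMonoidHom.ext (tensorAut_mul bU bW σ τ)

/-- The action of `GL_n(F) ∘ GL_m(F)` on `U ⊗ W`. -/
noncomputable def centralAut : CentralProduct F n m →* MulAut (Multiplicative (U ⊗[F] W)) :=
  QuotientGroup.lift _ (autOfEnd (matrixEnd bU bW)) <| by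
    rintro _ ⟨c, rfl⟩
    refine MulEquiv.ext fun x => congrArg Multiplicative.ofAdd
      (?_ : matrixEnd bU bW _ x.toAdd = x.toAdd)
    induction x.toAdd using TensorProduct.induction_on with
    | zero => exact map_zero _
    | tmul u w =>
      rw [matrixEnd_tmul, toLin_scalar, toLin_scalar, TensorProduct.smul_tmul_smul]
      simp
    | add x y hx hy => rw [map_add, hx, hy]

theorem coordAut_toLin {k : ℕ} {M : Type*} [AddCommGroup M] [Module F M]
    (b : Module.Basis (Fin k) F M) (σ : F ≃+* F) (A : GL (Fin k) F) (x : M) :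
    coordAut b σ (Matrix.toLin b b A.val x) =
      Matrix.toLin b b (Matrix.GeneralLinearGroup.map (σ : F →+* F) A).val (coordAut b σ x) := by
  apply b.equivFun.injective
  ext i
  simp [coordAut, Matrix.toLin_apply, Matrix.mulVec, dotProduct, Finsupp.single_apply, mul_comm]

theorem fieldEnd_matrixEnd (σ : F ≃+* F) (a : GL (Fin n) F × GL (Fin m) F) (x : U ⊗[F] W) :
    fieldEnd bU bW σ (matrixEnd bU bW a x) =
      matrixEnd bU bW (pairMap σ a) (fieldEnd bU bW σ x) := by
  induction x using TensorProduct.induction_on with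
  | zero => simp only [map_zero]
  | tmul u w =>
    change coordAut bU σ _ ⊗ₜ[F] coordAut bW σ _ = _
    rw [coordAut_toLin, coordAut_toLin]
    rfl
  | add x y hx hy => simp only [map_add, hx, hy]

/-- The action of `(GL_n(F) ∘ GL_m(F)) : Aut(F)` on `U ⊗ W`. -/
noncomputable def semilinearAut : CentralProduct F n m ⋊[centralAction F n m] (F ≃+* F) →*
    MulAut (Multiplicative (U ⊗[F] W)) :=
  SemidirectProduct.lift (centralAut bU bW) (autOfEnd (fieldEnd bU bW)) <| by
    intro σ
    refine MonoidHom.ext fun c => ?_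
    induction c using QuotientGroup.induction_on with
    | H a =>
      change autOfEnd (matrixEnd bU bW) (pairMap σ a) = autOfEnd (fieldEnd bU bW) σ *
        autOfEnd (matrixEnd bU bW) a * (autOfEnd (fieldEnd bU bW) σ)⁻¹
      rw [eq_mul_inv_iff_mul_eq]
      exact MulEquiv.ext fun x =>
        congrArg Multiplicative.ofAdd (fieldEnd_matrixEnd bU bW σ a x.toAdd).symm

/-- The abstract group `V : ((GL_n(F) ∘ GL_m(F)) : Aut(F))`, where `V = U ⊗ W`. -/
abbrev AffineGroup : Type _ :=
  Multiplicative (U ⊗[F] W) ⋊[semilinearAut bU bW]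
    (CentralProduct F n m ⋊[centralAction F n m] (F ≃+* F))

end

end TensorPLS

/-!
Write `V = U ⊗ W` and fix a basis `b 0, b 1` of `U`, so that every element of `V` is uniquely
`b 0 ⊗ x + b 1 ⊗ y`.

**The lines `u ⊗ W + v`.** Two such lines with independent directions meet in exactly one point,
so the structure is a net: parallel lines are those that are equal or disjoint, and an
automorphism `g` permutes the parallel classes (`exists_direction_image`). Suppose that `g` fixes
the origin. The classes of `b 0`, `b 1`, `b 0 + b 1` go to three different classes, and as `U` is a
plane these are the classes of `f 0`, `f 1`, `f 0 + f 1` for a basis `f` (`exists_basis_image`).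
The first two classes force `g (b 0 ⊗ x + b 1 ⊗ y) = f 0 ⊗ α x + f 1 ⊗ β y`, and the third forces
`α = β` and the additivity of `α` (`exists_additive_coordinates`). As `g` also permutes the
remaining classes, of directions `b 0 + c • b 1`, there is a map `σ` with `α (c • w) = σ c • α w`,
and `σ` is a field automorphism (`exists_semilinear_coordinates`). Hence `g` is the composite of
the coordinatewise action of `σ` and of some `A ⊗ h` (`autGroup_linesW_le`).

**The lines `U ⊗ w + v`.** Two points are collinear if and only if their difference is a pure
tensor, which is the collinearity relation of the other structure too. A clique of this relation
lies in a line of one of the two kinds (`IsPureClique.exists_line`), so a permutation that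
preserves the lines of the first kind preserves those of the second (`autGroup_linesU_le`), and
the previous case applies.

**The group.** The affine action of the external semidirect product on `V` is faithful, because
`A ⊗ B` is the identity only when `A` and `B` are mutually inverse scalars
(`semilinearAut_injective`). Its image preserves both line sets, so it is the full automorphism
group, and both internal semidirect decompositions are images of the external ones
(`isSplitExtension_range`).
-/

namespace TensorPLS

variable {F U W : Type*} [Field F] [AddCommGroup U] [Module F U] [AddCommGroup W] [Module F W]

/-! ### Pure tensors over a field -/

/-- Contraction of the first factor against a functional: `u ⊗ w ↦ f u • w`. -/
noncomputable def contractFst (f : U →ₗ[F] F) : U ⊗[F] W →ₗ[F] W :=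
  (TensorProduct.lid F W).toLinearMap ∘ₗ f.rTensor W

/-- Contraction of the second factor against a functional: `u ⊗ w ↦ f w • u`. -/
noncomputable def contractSnd (f : W →ₗ[F] F) : U ⊗[F] W →ₗ[F] U :=
  (TensorProduct.rid F U).toLinearMap ∘ₗ f.lTensor U

@[simp]
theorem contractFst_tmul (f : U →ₗ[F] F) (u : U) (w : W) :
    contractFst f (u ⊗ₜ[F] w) = f u • w := by
  simp [contractFst]

@[simp]
theorem contractSnd_tmul (f : W →ₗ[F] F) (u : U) (w : W) :
    contractSnd f (u ⊗ₜ[F] w) = f w • u := by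
  simp [contractSnd]

theorem exists_functional_of_notMem_span {M : Type*} [AddCommGroup M] [Module F M] {p u : M}
    (h : u ∉ Submodule.span F {p}) : ∃ f : M →ₗ[F] F, f p = 0 ∧ f u = 1 := by
  obtain ⟨f, hf, hp⟩ := Submodule.exists_le_ker_of_notMem h
  refine ⟨(f u)⁻¹ • f, ?_, by simp [hf]⟩
  have : f p = 0 := hp (Submodule.mem_span_singleton_self p)
  simp [this]

theorem exists_functional_of_ne_zero {M : Type*} [AddCommGroup M] [Module F M] {u : M}
    (h : u ≠ 0) : ∃ f : M →ₗ[F] F, f u = 1 := by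
  obtain ⟨f, -, hf⟩ := exists_functional_of_notMem_span (F := F) (p := (0 : M)) (u := u)
    (by simpa using h)
  exact ⟨f, hf⟩

theorem mem_span_singleton_symm {M : Type*} [AddCommGroup M] [Module F M] {p u : M}
    (hu : u ≠ 0) (h : u ∈ Submodule.span F {p}) : p ∈ Submodule.span F {u} := by
  obtain ⟨c, rfl⟩ := Submodule.mem_span_singleton.mp h
  have hc : c ≠ 0 := by rintro rfl; simp at hu
  exact Submodule.mem_span_singleton.mpr ⟨c⁻¹, by rw [smul_smul, inv_mul_cancel₀ hc, one_smul]⟩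

theorem tmul_ne_zero {u : U} {w : W} (hu : u ≠ 0) (hw : w ≠ 0) : u ⊗ₜ[F] w ≠ 0 := by
  obtain ⟨f, hf⟩ := exists_functional_of_ne_zero (F := F) hu
  intro h
  apply hw
  simpa [hf] using congrArg (contractFst f) h

theorem tmul_right_injective {u : U} (hu : u ≠ 0) :
    Function.Injective fun w : W => u ⊗ₜ[F] w := by
  intro w w' h
  obtain ⟨f, hf⟩ := exists_functional_of_ne_zero (F := F) hu
  simpa [hf] using congrArg (contractFst f) h

variable (F W) in
/-- The subspace `u ⊗ W` of `U ⊗ W`. -/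
noncomputable def dirW (u : U) : Submodule F (U ⊗[F] W) :=
  LinearMap.range (TensorProduct.mk F U W u)

variable (F U) in
/-- The subspace `U ⊗ w` of `U ⊗ W`. -/
noncomputable def dirU (w : W) : Submodule F (U ⊗[F] W) :=
  LinearMap.range ((TensorProduct.mk F U W).flip w)

theorem mem_dirW {u : U} {x : U ⊗[F] W} : x ∈ dirW F W u ↔ ∃ w, u ⊗ₜ[F] w = x := Iff.rfl

theorem mem_dirU {w : W} {x : U ⊗[F] W} : x ∈ dirU F U w ↔ ∃ u, u ⊗ₜ[F] w = x := Iff.rfl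

theorem tmul_mem_dirW (u : U) (w : W) : u ⊗ₜ[F] w ∈ dirW F W u := ⟨w, rfl⟩

theorem tmul_mem_dirU (u : U) (w : W) : u ⊗ₜ[F] w ∈ dirU F U w := ⟨u, rfl⟩

theorem dirW_eq_of_mem_span {u p : U} (hu : u ≠ 0) (h : u ∈ Submodule.span F {p}) :
    dirW F W u = dirW F W p := by
  have key : ∀ {a b : U}, a ∈ Submodule.span F {b} → dirW F W a ≤ dirW F W b := by
    rintro a b h _ ⟨w, rfl⟩
    obtain ⟨c, rfl⟩ := Submodule.mem_span_singleton.mp h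
    exact ⟨c • w, by simp⟩
  exact le_antisymm (key h) (key (mem_span_singleton_symm hu h))

theorem dirU_eq_of_mem_span {w p : W} (hw : w ≠ 0) (h : w ∈ Submodule.span F {p}) :
    dirU F U w = dirU F U p := by
  have key : ∀ {a b : W}, a ∈ Submodule.span F {b} → dirU F U a ≤ dirU F U b := by
    rintro a b h _ ⟨u, rfl⟩
    obtain ⟨c, rfl⟩ := Submodule.mem_span_singleton.mp h
    exact ⟨c • u, by simp⟩
  exact le_antisymm (key h) (key (mem_span_singleton_symm hw h))

theorem mem_span_of_mem_dirW {u p : U} {x : U ⊗[F] W} (hx : x ≠ 0) (hu : x ∈ dirW F W u)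
    (hp : x ∈ dirW F W p) : u ∈ Submodule.span F {p} := by
  by_contra h
  obtain ⟨f, hfp, hfu⟩ := exists_functional_of_notMem_span h
  obtain ⟨w, rfl⟩ := hu
  obtain ⟨w', hw'⟩ := hp
  have h := congrArg (contractFst f) hw'
  simp only [TensorProduct.mk_apply, contractFst_tmul, hfp, hfu, zero_smul, one_smul] at h
  simp [← h] at hx

theorem mem_span_of_mem_dirU {w p : W} {x : U ⊗[F] W} (hx : x ≠ 0) (hw : x ∈ dirU F U w)
    (hp : x ∈ dirU F U p) : w ∈ Submodule.span F {p} := by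
  by_contra h
  obtain ⟨f, hfp, hfw⟩ := exists_functional_of_notMem_span h
  obtain ⟨u, rfl⟩ := hw
  obtain ⟨u', hu'⟩ := hp
  have h := congrArg (contractSnd f) hu'
  simp only [TensorProduct.mk_apply, LinearMap.flip_apply, contractSnd_tmul, hfp, hfw, zero_smul,
    one_smul] at h
  simp [← h] at hx

theorem ne_zero_of_notMem_span {M : Type*} [AddCommGroup M] [Module F M] {p u : M}
    (h : u ∉ Submodule.span F {p}) : u ≠ 0 := by
  rintro rfl
  exact h (zero_mem _)

/-- The difference of two pure tensors whose first factors are independent and whose second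
factors are independent has rank two, so it is not pure. -/
theorem tmul_sub_tmul_ne_tmul {u u' a : U} {w w' b : W} (hu : u ≠ 0)
    (hu' : u' ∉ Submodule.span F {u}) (hw : w ≠ 0) (hw' : w' ∉ Submodule.span F {w}) :
    u' ⊗ₜ[F] w - u ⊗ₜ[F] w' ≠ a ⊗ₜ[F] b := by
  intro h
  obtain ⟨f, hf, hf'⟩ := exists_functional_of_notMem_span hu'
  obtain ⟨g, hg, hg'⟩ := exists_functional_of_notMem_span
    (fun h => hu' (mem_span_singleton_symm hu h))
  have h₁ := congrArg (contractFst f) h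
  have h₂ := congrArg (contractFst g) h
  simp only [map_sub, contractFst_tmul, hf, hf', hg, hg', zero_smul, one_smul, sub_zero,
    zero_sub] at h₁ h₂
  have hga : w' = (-g a) • b := by rw [neg_smul, ← h₂, neg_neg]
  have hb : b ∈ Submodule.span F {w} :=
    mem_span_singleton_symm hw (Submodule.mem_span_singleton.mpr ⟨_, h₁.symm⟩)
  exact hw' (hga ▸ Submodule.smul_mem _ _ hb)

/-! ### Lines as translates of subspaces -/

theorem mem_linesW {L : Set (U ⊗[F] W)} :
    L ∈ linesW F U W ↔ ∃ u : U, u ≠ 0 ∧ ∃ v, L = {x | x - v ∈ dirW F W u} := by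
  have (u : U) (v : U ⊗[F] W) :
      {x | ∃ w : W, x = u ⊗ₜ[F] w + v} = {x | x - v ∈ dirW F W u} := by
    ext x
    simp only [Set.mem_ofPred_eq, mem_dirW, eq_sub_iff_add_eq, eq_comm (a := x)]
  simp only [linesW, Set.mem_ofPred_eq, this]

theorem mem_linesU {L : Set (U ⊗[F] W)} :
    L ∈ linesU F U W ↔ ∃ w : W, w ≠ 0 ∧ ∃ v, L = {x | x - v ∈ dirU F U w} := by
  have (w : W) (v : U ⊗[F] W) :
      {x | ∃ u : U, x = u ⊗ₜ[F] w + v} = {x | x - v ∈ dirU F U w} := by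
    ext x
    simp only [Set.mem_ofPred_eq, mem_dirU, eq_sub_iff_add_eq, eq_comm (a := x)]
  simp only [linesU, Set.mem_ofPred_eq, this]

/-- A translate of a subspace may be based at any of its points. -/
theorem translate_eq_of_mem {V : Type*} [AddCommGroup V] [Module F V] {D : Submodule F V}
    {v x : V} (hx : x ∈ {z | z - v ∈ D}) : {z | z - v ∈ D} = {z | z - x ∈ D} := by
  ext z
  have h : z - v = (z - x) + (x - v) := by abel
  exact (h ▸ D.add_mem_iff_left hx : z - v ∈ D ↔ z - x ∈ D)

theorem isPartialLinearSpace_linesW [Nontrivial W] :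
    IsPartialLinearSpace (linesW F U W) where
  nonempty := ⟨0⟩
  two_points := by
    intro L hL
    obtain ⟨u, hu, v, rfl⟩ := mem_linesW.mp hL
    obtain ⟨w, hw⟩ := exists_ne (0 : W)
    exact ⟨v, by simp, u ⊗ₜ w + v, by simp [tmul_mem_dirW], by simpa using tmul_ne_zero hu hw⟩
  unique_line := by
    intro L hL M hM x y hxy hxL hyL hxM hyM
    obtain ⟨u, hu, v, rfl⟩ := mem_linesW.mp hL
    obtain ⟨p, hp, v', rfl⟩ := mem_linesW.mp hM
    rw [translate_eq_of_mem hxL] at hyL ⊢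
    rw [translate_eq_of_mem hxM] at hyM ⊢
    rw [dirW_eq_of_mem_span hu (mem_span_of_mem_dirW (sub_ne_zero.mpr hxy.symm) hyL hyM)]

theorem isPartialLinearSpace_linesU [Nontrivial U] :
    IsPartialLinearSpace (linesU F U W) where
  nonempty := ⟨0⟩
  two_points := by
    intro L hL
    obtain ⟨w, hw, v, rfl⟩ := mem_linesU.mp hL
    obtain ⟨u, hu⟩ := exists_ne (0 : U)
    exact ⟨v, by simp, u ⊗ₜ w + v, by simp [tmul_mem_dirU], by simpa using tmul_ne_zero hu hw⟩
  unique_line := by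
    intro L hL M hM x y hxy hxL hyL hxM hyM
    obtain ⟨u, hu, v, rfl⟩ := mem_linesU.mp hL
    obtain ⟨p, hp, v', rfl⟩ := mem_linesU.mp hM
    rw [translate_eq_of_mem hxL] at hyL ⊢
    rw [translate_eq_of_mem hxM] at hyM ⊢
    rw [dirU_eq_of_mem_span hu (mem_span_of_mem_dirU (sub_ne_zero.mpr hxy.symm) hyL hyM)]

/-! ### Cliques of the collinearity graph -/

/-- The set `C` is a clique for the relation that `x - y` is a pure tensor. -/
def IsPureClique (C : Set (U ⊗[F] W)) : Prop :=
  ∀ x ∈ C, ∀ y ∈ C, ∃ (u : U) (w : W), x - y = u ⊗ₜ[F] w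

/-- Two differences in a clique, one pointing out of `u ⊗ W` and the other out of `U ⊗ w`, would
make a third difference of rank two. -/
theorem IsPureClique.exists_line {C : Set (U ⊗[F] W)} (hC : IsPureClique C)
    (hC' : C.Nontrivial) :
    (∃ M ∈ linesU F U W, C ⊆ M) ∨ ∃ M ∈ linesW F U W, C ⊆ M := by
  obtain ⟨v, hv, x, hx, hvx⟩ := hC'
  obtain ⟨u, w, huw⟩ := hC x hx v hv
  have hne : u ⊗ₜ[F] w ≠ 0 := huw ▸ sub_ne_zero.mpr hvx.symm
  have hu : u ≠ 0 := by rintro rfl; simp at hne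
  have hw : w ≠ 0 := by rintro rfl; simp at hne
  -- every point of the clique lies on one of the two lines through `v` and `x`
  have key : ∀ y ∈ C, y - v ∈ dirU F U w ∨ y - v ∈ dirW F W u := by
    intro y hy
    obtain ⟨a, b, hab⟩ := hC y hy v hv
    obtain ⟨c, d, hcd⟩ := hC y hy x hx
    by_cases ha : a ∈ Submodule.span F {u}
    · obtain ⟨s, rfl⟩ := Submodule.mem_span_singleton.mp ha
      exact Or.inr ⟨s • b, by rw [hab, TensorProduct.smul_tmul]; rfl⟩
    by_cases hb : w ∈ Submodule.span F {b}
    · obtain ⟨s, rfl⟩ := Submodule.mem_span_singleton.mp (mem_span_singleton_symm hw hb)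
      exact Or.inl ⟨s • a, by rw [hab]; simp⟩
    by_cases hb₀ : b = 0
    · exact Or.inl ⟨0, by rw [hab, hb₀]; simp⟩
    refine absurd ?_ (tmul_sub_tmul_ne_tmul (a := c) (b := d) hu ha hb₀ hb)
    rw [← hab, ← huw, ← hcd]
    abel
  by_contra! h
  obtain ⟨y, hy, hyU⟩ := Set.not_subset.mp
    (h.1 {z | z - v ∈ dirU F U w} (mem_linesU.mpr ⟨w, hw, v, rfl⟩))
  obtain ⟨z, hz, hzW⟩ := Set.not_subset.mp
    (h.2 {z | z - v ∈ dirW F W u} (mem_linesW.mpr ⟨u, hu, v, rfl⟩))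
  obtain ⟨w', hw'⟩ := (key y hy).resolve_left hyU
  obtain ⟨u', hu'⟩ := (key z hz).resolve_right hzW
  rw [TensorProduct.mk_apply] at hw'
  rw [LinearMap.flip_apply, TensorProduct.mk_apply] at hu'
  obtain ⟨c, d, hcd⟩ := hC z hz y hy
  have hsub : u' ⊗ₜ[F] w - u ⊗ₜ[F] w' = c ⊗ₜ[F] d := by
    rw [hu', hw', ← hcd]
    abel
  refine tmul_sub_tmul_ne_tmul hu ?_ hw ?_ hsub
  · intro hs
    obtain ⟨s, rfl⟩ := Submodule.mem_span_singleton.mp hs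
    exact hzW ⟨s • w, by rw [← hu', TensorProduct.smul_tmul]; rfl⟩
  · intro hs
    obtain ⟨s, rfl⟩ := Submodule.mem_span_singleton.mp hs
    exact hyU ⟨s • u, by rw [← hw']; simp⟩

/-! ### Automorphisms of the first line set preserve the second -/

theorem le_autGroup {P : Type*} {lines : Set (Set P)} {H : Subgroup (Equiv.Perm P)}
    (h : ∀ g ∈ H, ∀ L ∈ lines, g '' L ∈ lines) : H ≤ autGroup lines := by
  refine fun g hg L => ⟨fun hL => ?_, h g hg L⟩
  have := h g⁻¹ (inv_mem hg) _ hL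
  rwa [← Set.image_comp, ← Equiv.Perm.coe_mul, inv_mul_cancel, Equiv.Perm.coe_one,
    Set.image_id] at this

theorem exists_mem_linesU_iff {x y : U ⊗[F] W} (hxy : x ≠ y) :
    (∃ L ∈ linesU F U W, x ∈ L ∧ y ∈ L) ↔ ∃ (u : U) (w : W), x - y = u ⊗ₜ[F] w := by
  constructor
  · rintro ⟨L, hL, hx, hy⟩
    obtain ⟨w, hw, v, rfl⟩ := mem_linesU.mp hL
    rw [translate_eq_of_mem hy] at hx
    obtain ⟨u, hu⟩ := hx
    exact ⟨u, w, hu.symm⟩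
  · rintro ⟨u, w, h⟩
    have hw : w ≠ 0 := by
      rintro rfl
      exact hxy (sub_eq_zero.mp (by rw [h, TensorProduct.tmul_zero]))
    exact ⟨_, mem_linesU.mpr ⟨w, hw, y, rfl⟩, ⟨u, h.symm⟩, by simp⟩

theorem IsPureClique.image {g : Equiv.Perm (U ⊗[F] W)} (hg : g ∈ autGroup (linesU F U W))
    {C : Set (U ⊗[F] W)} (hC : IsPureClique C) : IsPureClique (g '' C) := by
  rintro _ ⟨x, hx, rfl⟩ _ ⟨y, hy, rfl⟩
  by_cases hxy : x = y
  · exact ⟨0, 0, by simp [hxy]⟩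
  rw [← exists_mem_linesU_iff (g.injective.ne hxy)]
  obtain ⟨L, hL, hxL, hyL⟩ := (exists_mem_linesU_iff hxy).mpr (hC x hx y hy)
  exact ⟨g '' L, (hg L).mpr hL, ⟨x, hxL, rfl⟩, ⟨y, hyL, rfl⟩⟩

theorem isPureClique_of_mem_linesW {L : Set (U ⊗[F] W)} (hL : L ∈ linesW F U W) :
    IsPureClique L := by
  obtain ⟨u, -, v, rfl⟩ := mem_linesW.mp hL
  intro x hx y hy
  rw [translate_eq_of_mem hy] at hx
  obtain ⟨w, hw⟩ := hx
  exact ⟨u, w, hw.symm⟩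

/-- When `dim W ≥ 2`, a line `u ⊗ W + v` contains points whose difference lies outside `U ⊗ w`. -/
theorem not_subset_of_mem_linesW (hW : ∀ w : W, ∃ w', w' ∉ Submodule.span F {w})
    {L M : Set (U ⊗[F] W)} (hL : L ∈ linesW F U W) (hM : M ∈ linesU F U W) : ¬ L ⊆ M := by
  intro h
  obtain ⟨u, hu, v, rfl⟩ := mem_linesW.mp hL
  obtain ⟨w, hw, v', rfl⟩ := mem_linesU.mp hM
  obtain ⟨w', hw'⟩ := hW w
  have hv : v ∈ {x | x - v' ∈ dirU F U w} := h (by simp)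
  rw [translate_eq_of_mem hv] at h
  have h' : u ⊗ₜ w' + v ∈ {x | x - v ∈ dirU F U w} := h (by simp [tmul_mem_dirW])
  rw [Set.mem_ofPred_eq, add_sub_cancel_right] at h'
  exact hw' (mem_span_of_mem_dirU (tmul_ne_zero hu (ne_zero_of_notMem_span hw'))
    (tmul_mem_dirU u w') h')

/-- The lines `u ⊗ W + v` are the maximal cliques of the collinearity graph of `linesU` that are
not lines of `linesU`, so the automorphisms of `linesU` preserve them. -/
theorem autGroup_linesU_le (hW : ∀ w : W, ∃ w', w' ∉ Submodule.span F {w}) :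
    autGroup (linesU F U W) ≤ autGroup (linesW F U W) := by
  have : Nontrivial W := by
    obtain ⟨w, hw⟩ := hW 0
    exact ⟨w, 0, ne_zero_of_notMem_span hw⟩
  have hP : IsPartialLinearSpace (linesW F U W) := isPartialLinearSpace_linesW
  have key : ∀ g ∈ autGroup (linesU F U W), ∀ L ∈ linesW F U W,
      ∃ M ∈ linesW F U W, g '' L ⊆ M := by
    intro g hg L hL
    refine (((isPureClique_of_mem_linesW hL).image hg).exists_line
      ((hP.two_points L hL).image g.injective)).resolve_left ?_
    rintro ⟨M, hM, hLM⟩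
    refine not_subset_of_mem_linesW hW hL (M := (g⁻¹ : Equiv.Perm _) '' M)
      ((inv_mem hg M).mpr hM) fun x hx => ⟨g x, hLM ⟨x, hx, rfl⟩, by simp⟩
  refine le_autGroup fun g hg L hL => ?_
  obtain ⟨M, hM, hLM⟩ := key g hg L hL
  obtain ⟨L', hL', hML⟩ := key g⁻¹ (inv_mem hg) M hM
  have hLL : ∀ x ∈ L, x ∈ L' := fun x hx => hML ⟨g x, hLM ⟨x, hx, rfl⟩, by simp⟩
  obtain ⟨x, hx, y, hy, hxy⟩ := hP.two_points L hL
  obtain rfl := hP.unique_line L hL L' hL' x y hxy hx hy (hLL x hx) (hLL y hy)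
  suffices g '' L = M by rwa [this]
  exact hLM.antisymm fun z hz => ⟨g⁻¹ z, hML ⟨z, hz, rfl⟩, by simp⟩

/-! ### The net of translates of the subspaces `u ⊗ W` -/

theorem linearIndependent_pair_of_notMem_span {p u : U} (hp : p ≠ 0)
    (hu : u ∉ Submodule.span F {p}) : LinearIndependent F ![p, u] :=
  (LinearIndependent.pair_iff' hp).mpr fun c hc => hu (Submodule.mem_span_singleton.mpr ⟨c, hc⟩)

/-- Two independent vectors of a plane, as a basis. -/
noncomputable def basisOfPair (bU : Module.Basis (Fin 2) F U) {p u : U} (hp : p ≠ 0)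
    (hu : u ∉ Submodule.span F {p}) : Module.Basis (Fin 2) F U :=
  basisOfLinearIndependentOfCardEqFinrank (linearIndependent_pair_of_notMem_span hp hu)
    (Module.finrank_eq_card_basis bU).symm

theorem basisOfPair_zero (bU : Module.Basis (Fin 2) F U) {p u : U} (hp : p ≠ 0)
    (hu : u ∉ Submodule.span F {p}) : basisOfPair bU hp hu 0 = p := by
  simp [basisOfPair]

theorem basisOfPair_one (bU : Module.Basis (Fin 2) F U) {p u : U} (hp : p ≠ 0)
    (hu : u ∉ Submodule.span F {p}) : basisOfPair bU hp hu 1 = u := by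
  simp [basisOfPair]

theorem notMem_span_basis (b : Module.Basis (Fin 2) F U) : b 1 ∉ Submodule.span F {b 0} := by
  intro h
  obtain ⟨c, hc⟩ := Submodule.mem_span_singleton.mp h
  simpa using congrArg (fun x => b.repr x 1) hc

theorem exists_tmul_add_tmul (b : Module.Basis (Fin 2) F U) (x : U ⊗[F] W) :
    ∃ w₀ w₁ : W, x = b 0 ⊗ₜ w₀ + b 1 ⊗ₜ w₁ := by
  induction x using TensorProduct.induction_on with
  | zero => exact ⟨0, 0, by simp⟩
  | tmul u w =>
    refine ⟨b.repr u 0 • w, b.repr u 1 • w, ?_⟩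
    rw [← TensorProduct.smul_tmul, ← TensorProduct.smul_tmul, ← TensorProduct.add_tmul,
      ← Fin.sum_univ_two fun i => b.repr u i • b i, b.sum_repr]
  | add x y hx hy =>
    obtain ⟨a, c, rfl⟩ := hx
    obtain ⟨a', c', rfl⟩ := hy
    exact ⟨a + a', c + c', by simp only [TensorProduct.tmul_add]; abel⟩

theorem tmul_add_tmul_inj (b : Module.Basis (Fin 2) F U) {w₀ w₁ w₀' w₁' : W}
    (h : b 0 ⊗ₜ[F] w₀ + b 1 ⊗ₜ[F] w₁ = b 0 ⊗ₜ w₀' + b 1 ⊗ₜ w₁') : w₀ = w₀' ∧ w₁ = w₁' := by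
  have h₀ := congrArg (contractFst (b.coord 0)) h
  have h₁ := congrArg (contractFst (b.coord 1)) h
  exact ⟨by simpa using h₀, by simpa using h₁⟩

theorem exists_dirW_image {g : Equiv.Perm (U ⊗[F] W)} (hg : g ∈ autGroup (linesW F U W))
    {u : U} (hu : u ≠ 0) (v : U ⊗[F] W) :
    ∃ p : U, p ≠ 0 ∧ ∀ z, z - v ∈ dirW F W u ↔ g z - g v ∈ dirW F W p := by
  obtain ⟨p, hp, v', hL⟩ := mem_linesW.mp ((hg _).mpr (mem_linesW.mpr ⟨u, hu, v, rfl⟩))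
  have hv : g v ∈ {x | x - v' ∈ dirW F W p} := hL ▸ ⟨v, by simp, rfl⟩
  rw [translate_eq_of_mem hv] at hL
  refine ⟨p, hp, fun z => ?_⟩
  have := Set.ext_iff.mp hL (g z)
  rwa [Set.mem_ofPred_eq, g.injective.mem_set_image] at this

/-- Two lines are parallel if and only if they are equal or disjoint, so an automorphism maps
parallel classes to parallel classes. -/
theorem exists_direction_image (bU : Module.Basis (Fin 2) F U) {g : Equiv.Perm (U ⊗[F] W)}
    (hg : g ∈ autGroup (linesW F U W)) {u : U} (hu : u ≠ 0) :
    ∃ p : U, p ≠ 0 ∧ ∀ z v, z - v ∈ dirW F W u ↔ g z - g v ∈ dirW F W p := by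
  obtain ⟨p, hp, h⟩ := exists_dirW_image hg hu 0
  refine ⟨p, hp, fun z v => ?_⟩
  obtain ⟨p', hp', h'⟩ := exists_dirW_image hg hu v
  by_cases hpp : p' ∈ Submodule.span F {p}
  · rw [h' z, dirW_eq_of_mem_span hp' hpp]
  -- otherwise the images of the lines through `0` and `v` meet, so these lines coincide
  obtain ⟨w, w', hw⟩ := exists_tmul_add_tmul (basisOfPair bU hp hpp) (g v - g 0)
  rw [basisOfPair_zero, basisOfPair_one] at hw
  obtain ⟨y, hy⟩ := g.surjective (g 0 + p ⊗ₜ w)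
  have hy₀ : y - 0 ∈ dirW F W u := (h y).mpr (by rw [hy]; simp [tmul_mem_dirW])
  have hy₁ : y - v ∈ dirW F W u := by
    rw [h', hy, ← neg_mem_iff]
    exact ⟨w', by rw [sub_eq_iff_eq_add.mp hw, TensorProduct.mk_apply]; abel⟩
  have hv : v - 0 ∈ dirW F W u := by
    simpa using sub_mem hy₀ hy₁
  have hz : z - v ∈ dirW F W u ↔ z - 0 ∈ dirW F W u := by
    rw [← sub_add_sub_cancel z v 0]
    exact ((dirW F W u).add_mem_iff_left hv).symm
  rw [hz, h z, ← sub_add_sub_cancel (g z) (g v) (g 0)]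
  exact (dirW F W p).add_mem_iff_left ((h v).mp hv)

theorem notMem_span_image [Nontrivial W] {g : Equiv.Perm (U ⊗[F] W)} {u u' p p' : U}
    (hu' : u' ∉ Submodule.span F {u}) (hp' : p' ≠ 0)
    (h : ∀ z v, z - v ∈ dirW F W u ↔ g z - g v ∈ dirW F W p)
    (h' : ∀ z v, z - v ∈ dirW F W u' ↔ g z - g v ∈ dirW F W p') :
    p' ∉ Submodule.span F {p} := by
  intro hpp
  obtain ⟨w, hw⟩ := exists_ne (0 : W)
  refine hu' (mem_span_of_mem_dirW (tmul_ne_zero (ne_zero_of_notMem_span hu') hw)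
    (tmul_mem_dirW u' w) ?_)
  have := (h' (u' ⊗ₜ w) 0).mp (by simp [tmul_mem_dirW])
  rw [dirW_eq_of_mem_span hp' hpp, ← h, sub_zero] at this
  exact this

/-- The images of the directions `b 0`, `b 1` and `b 0 + b 1` are three distinct directions of the
plane `U`, so suitable vectors spanning them are again of the form `f 0`, `f 1`, `f 0 + f 1`. -/
theorem exists_basis_image [Nontrivial W] (b : Module.Basis (Fin 2) F U)
    {g : Equiv.Perm (U ⊗[F] W)} (hg : g ∈ autGroup (linesW F U W)) :
    ∃ f : Module.Basis (Fin 2) F U,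
      (∀ z v, z - v ∈ dirW F W (b 0) ↔ g z - g v ∈ dirW F W (f 0)) ∧
      (∀ z v, z - v ∈ dirW F W (b 1) ↔ g z - g v ∈ dirW F W (f 1)) ∧
      ∀ z v, z - v ∈ dirW F W (b 0 + b 1) ↔ g z - g v ∈ dirW F W (f 0 + f 1) := by
  have hb := notMem_span_basis b
  have hb' : b 0 + b 1 ∉ Submodule.span F {b 0} := by
    rwa [Submodule.add_mem_iff_right _ (Submodule.mem_span_singleton_self _)]
  have hb'' : b 0 + b 1 ∉ Submodule.span F {b 1} := by
    rw [Submodule.add_mem_iff_left _ (Submodule.mem_span_singleton_self _)]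
    exact fun h => hb (mem_span_singleton_symm (b.ne_zero 0) h)
  obtain ⟨p, hp, h₀⟩ := exists_direction_image b hg (b.ne_zero 0)
  obtain ⟨q, hq, h₁⟩ := exists_direction_image b hg (b.ne_zero 1)
  obtain ⟨r, hr, h₂⟩ := exists_direction_image b hg (ne_zero_of_notMem_span hb')
  have hpq := notMem_span_image hb hq h₀ h₁
  have hpr := notMem_span_image hb' hr h₀ h₂
  have hqr := notMem_span_image hb'' hr h₁ h₂
  have hsum := (basisOfPair b hp hpq).sum_repr r
  rw [Fin.sum_univ_two, basisOfPair_zero, basisOfPair_one] at hsum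
  generalize (basisOfPair b hp hpq).repr r 0 = s at hsum
  generalize (basisOfPair b hp hpq).repr r 1 = t at hsum
  have hs : s ≠ 0 := by
    rintro rfl
    exact hqr (Submodule.mem_span_singleton.mpr ⟨t, by rw [← hsum, zero_smul, zero_add]⟩)
  have ht : t ≠ 0 := by
    rintro rfl
    exact hpr (Submodule.mem_span_singleton.mpr ⟨s, by rw [← hsum, zero_smul, add_zero]⟩)
  have hsp : s • p ∈ Submodule.span F {p} := Submodule.mem_span_singleton.mpr ⟨s, rfl⟩
  have htq : t • q ∈ Submodule.span F {q} := Submodule.mem_span_singleton.mpr ⟨t, rfl⟩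
  have hsp₀ := smul_ne_zero hs hp
  have htq₀ := smul_ne_zero ht hq
  have hind : t • q ∉ Submodule.span F {s • p} := by
    rwa [Submodule.span_singleton_smul_eq hs.isUnit, Submodule.smul_mem_iff _ ht]
  refine ⟨basisOfPair b hsp₀ hind, ?_⟩
  rw [basisOfPair_zero, basisOfPair_one, hsum, dirW_eq_of_mem_span hsp₀ hsp,
    dirW_eq_of_mem_span htq₀ htq]
  exact ⟨h₀, h₁, h₂⟩

/-- An automorphism of the net fixing the origin is `b 0 ⊗ x + b 1 ⊗ y ↦ f 0 ⊗ α x + f 1 ⊗ α y` for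
an additive bijection `α`: the first two parallel classes make it split into coordinates, and
the third makes the coordinate maps equal and additive. -/
theorem exists_additive_coordinates [Nontrivial W] (b : Module.Basis (Fin 2) F U)
    {g : Equiv.Perm (U ⊗[F] W)} (hg : g ∈ autGroup (linesW F U W)) (hg₀ : g 0 = 0) :
    ∃ (f : Module.Basis (Fin 2) F U) (α : W ≃+ W),
      ∀ x y, g (b 0 ⊗ₜ x + b 1 ⊗ₜ y) = f 0 ⊗ₜ α x + f 1 ⊗ₜ α y := by
  obtain ⟨f, h₀, h₁, h₂⟩ := exists_basis_image b hg
  have hα : ∀ x : W, ∃ y : W, f 0 ⊗ₜ[F] y = g (b 0 ⊗ₜ x) := fun x => by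
    have := (h₀ (b 0 ⊗ₜ x) 0).mp (by simp [tmul_mem_dirW])
    rwa [hg₀, sub_zero] at this
  have hβ : ∀ x : W, ∃ y : W, f 1 ⊗ₜ[F] y = g (b 1 ⊗ₜ x) := fun x => by
    have := (h₁ (b 1 ⊗ₜ x) 0).mp (by simp [tmul_mem_dirW])
    rwa [hg₀, sub_zero] at this
  choose α hα using hα
  choose β hβ using hβ
  have hsplit : ∀ x y, g (b 0 ⊗ₜ x + b 1 ⊗ₜ y) = f 0 ⊗ₜ α x + f 1 ⊗ₜ β y := by
    intro x y
    obtain ⟨c, hc⟩ := (h₁ (b 0 ⊗ₜ x + b 1 ⊗ₜ y) (b 0 ⊗ₜ x)).mp (by simp [tmul_mem_dirW])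
    obtain ⟨d, hd⟩ := (h₀ (b 0 ⊗ₜ x + b 1 ⊗ₜ y) (b 1 ⊗ₜ y)).mp (by simp [tmul_mem_dirW])
    rw [TensorProduct.mk_apply, ← hα, eq_sub_iff_add_eq'] at hc
    rw [TensorProduct.mk_apply, ← hβ, eq_sub_iff_add_eq] at hd
    rw [← hc, (tmul_add_tmul_inj f (hc.trans hd.symm)).2]
  have hα₀ : α 0 = 0 := tmul_right_injective (F := F) (f.ne_zero 0) (by simp [hα, hg₀])
  have hβ₀ : β 0 = 0 := tmul_right_injective (F := F) (f.ne_zero 1) (by simp [hβ, hg₀])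
  have hdiff : ∀ x y, α (x + y) - α x = β y := by
    intro x y
    obtain ⟨c, hc⟩ := (h₂ (b 0 ⊗ₜ (x + y) + b 1 ⊗ₜ y) (b 0 ⊗ₜ x + b 1 ⊗ₜ 0)).mp
      ⟨y, by simp only [TensorProduct.mk_apply, TensorProduct.add_tmul, TensorProduct.tmul_add,
        TensorProduct.tmul_zero]; abel⟩
    rw [hsplit, hsplit, hβ₀, TensorProduct.mk_apply, TensorProduct.add_tmul,
      TensorProduct.tmul_zero, add_zero, add_sub_right_comm, ← TensorProduct.tmul_sub] at hc
    obtain ⟨h, h'⟩ := tmul_add_tmul_inj f hc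
    rw [← h, h']
  have hαβ : ∀ y, α y = β y := fun y => by simpa [hα₀] using hdiff 0 y
  have hadd : ∀ x y, α (x + y) = α x + α y := fun x y => by
    rw [← sub_eq_iff_eq_add', hdiff, hαβ]
  have hbij : Function.Bijective α := by
    constructor
    · intro x y hxy
      refine tmul_right_injective (F := F) (b.ne_zero 0) (g.injective ?_)
      change g (b 0 ⊗ₜ x) = g (b 0 ⊗ₜ y)
      rw [← hα, ← hα, hxy]
    · intro y
      obtain ⟨z, hz⟩ := g.surjective (f 0 ⊗ₜ y)
      obtain ⟨x, rfl⟩ : z ∈ dirW F W (b 0) := by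
        have := h₀ z 0
        rw [hg₀, sub_zero, sub_zero, hz] at this
        exact this.mpr (tmul_mem_dirW _ _)
      exact ⟨x, tmul_right_injective (F := F) (f.ne_zero 0) ((hα x).trans hz)⟩
  refine ⟨f, AddEquiv.ofBijective (AddMonoidHom.mk' α hadd) hbij, fun x y => ?_⟩
  rw [hsplit, ← hαβ]
  rfl

/-- The additive coordinate map is semilinear, because `g` permutes the directions
`b 0 + c • b 1`. Finiteness of `F` makes the resulting injective endomorphism `σ` surjective. -/
theorem exists_semilinear_coordinates [Finite F] [Nontrivial W] (b f : Module.Basis (Fin 2) F U)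
    {g : Equiv.Perm (U ⊗[F] W)} (hg : g ∈ autGroup (linesW F U W)) {α : W ≃+ W}
    (hα : ∀ x y, g (b 0 ⊗ₜ x + b 1 ⊗ₜ y) = f 0 ⊗ₜ α x + f 1 ⊗ₜ α y) :
    ∃ σ : F ≃+* F, ∀ c w, α (c • w) = σ c • α w := by
  have hg₀ : g 0 = 0 := by simpa using hα 0 0
  have key : ∀ c : F, ∃ d : F, ∀ w, α (c • w) = d • α w := by
    intro c
    have hne : b 0 + c • b 1 ≠ 0 := by
      intro h
      simpa using congrArg (fun x => b.repr x 0) h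
    obtain ⟨p, -, hp⟩ := exists_dirW_image hg hne 0
    have hw : ∀ w, ∃ y, α w = f.coord 0 p • y ∧ α (c • w) = f.coord 1 p • y := by
      intro w
      obtain ⟨y, hy⟩ := (hp (b 0 ⊗ₜ w + b 1 ⊗ₜ (c • w))).mp
        ⟨w, by simp⟩
      rw [hα, hg₀, sub_zero, TensorProduct.mk_apply] at hy
      refine ⟨y, ?_, ?_⟩
      · simpa using (congrArg (contractFst (f.coord 0)) hy).symm
      · simpa using (congrArg (contractFst (f.coord 1)) hy).symm
    have hs : f.coord 0 p ≠ 0 := by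
      obtain ⟨w, hw₀⟩ := exists_ne (0 : W)
      obtain ⟨y, hy, -⟩ := hw w
      intro h
      rw [h, zero_smul] at hy
      exact hw₀ (by simpa using hy)
    refine ⟨f.coord 1 p / f.coord 0 p, fun w => ?_⟩
    obtain ⟨y, hy, hy'⟩ := hw w
    rw [hy, hy', smul_smul, div_mul_cancel₀ _ hs]
  choose σ hσ using key
  obtain ⟨w, hw⟩ := exists_ne (0 : W)
  have hαw : α w ≠ 0 := by simpa using hw
  have hinj : Function.Injective fun c : F => c • α w := smul_left_injective F hαw
  let τ : F →+* F :=
    { toFun := σ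
      map_one' := hinj (by simp [← hσ])
      map_mul' := fun c d => hinj (by simp only [← hσ, mul_smul])
      map_zero' := hinj (by simp [← hσ])
      map_add' := fun c d => hinj (by simp only [← hσ, add_smul, map_add]) }
  exact ⟨RingEquiv.ofBijective τ (Finite.injective_iff_bijective.mp τ.injective), hσ⟩

/-! ### Semidirect products as permutation groups -/

/-- A faithful representation of an external semidirect product exhibits its image as an internal
one. -/
theorem isSplitExtension_range {N G X : Type*} [Group N] [Group G] [Group X] {φ : G →* MulAut N}
    {f : N ⋊[φ] G →* X} (hf : Function.Injective f) :
    IsSplitExtension f.range (f.comp SemidirectProduct.inl).range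
      (f.comp SemidirectProduct.inr).range where
  left_le := by
    rintro _ ⟨n, rfl⟩
    exact ⟨_, rfl⟩
  right_le := by
    rintro _ ⟨g, rfl⟩
    exact ⟨_, rfl⟩
  normal := by
    refine ⟨?_⟩
    rintro ⟨_, _⟩ ⟨n, rfl⟩ ⟨_, a, rfl⟩
    have h : a * SemidirectProduct.inl n * a⁻¹ ∈ (SemidirectProduct.inl : N →* N ⋊[φ] G).range := by
      rw [SemidirectProduct.range_inl_eq_ker_rightHom]
      simp [MonoidHom.mem_ker]
    obtain ⟨n', hn'⟩ := h
    exact ⟨n', by simp [hn']⟩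
  inf_eq := by
    rw [eq_bot_iff]
    rintro _ ⟨⟨n, rfl⟩, g, hg⟩
    have h := congrArg SemidirectProduct.left (hf hg)
    simp only [SemidirectProduct.left_inr, SemidirectProduct.left_inl] at h
    simp [← h]
  sup_eq := by
    refine le_antisymm (sup_le ?_ ?_) ?_
    · rintro _ ⟨n, rfl⟩
      exact ⟨_, rfl⟩
    · rintro _ ⟨g, rfl⟩
      exact ⟨_, rfl⟩
    · rintro _ ⟨a, rfl⟩
      rw [← SemidirectProduct.inl_left_mul_inr_right a, map_mul]
      exact mul_mem (Subgroup.mem_sup_left ⟨_, rfl⟩) (Subgroup.mem_sup_right ⟨_, rfl⟩)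

/-- The action of an additive group on itself by translations. -/
def translationHom (V : Type*) [AddCommGroup V] : Multiplicative V →* Equiv.Perm V where
  toFun v := Equiv.addRight v.toAdd
  map_one' := Equiv.ext fun x => add_zero x
  map_mul' v w := Equiv.ext fun x => by
    change x + (v.toAdd + w.toAdd) = x + w.toAdd + v.toAdd
    abel

/-- The action of the automorphisms of an additive group on its elements. -/
def automorphismHom (V : Type*) [AddCommGroup V] :
    MulAut (Multiplicative V) →* Equiv.Perm V where
  toFun e := (Multiplicative.ofAdd.trans e.toEquiv).trans Multiplicative.toAdd
  map_one' := rfl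
  map_mul' _ _ := rfl

/-- The affine action `x ↦ φ g x + v` of the semidirect product `V : G`. -/
def affineHom {V G : Type*} [AddCommGroup V] [Group G] (φ : G →* MulAut (Multiplicative V)) :
    Multiplicative V ⋊[φ] G →* Equiv.Perm V :=
  SemidirectProduct.lift (translationHom V) ((automorphismHom V).comp φ) fun g => by
    refine MonoidHom.ext fun v => Equiv.ext fun x => ?_
    change x + (φ g v).toAdd =
      (φ g ((φ g)⁻¹ (Multiplicative.ofAdd x) * v)).toAdd
    rw [map_mul, MulAut.apply_inv_self]
    rfl

theorem affineHom_apply {V G : Type*} [AddCommGroup V] [Group G]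
    (φ : G →* MulAut (Multiplicative V)) (a : Multiplicative V ⋊[φ] G) (x : V) :
    affineHom φ a x = (φ a.right (Multiplicative.ofAdd x)).toAdd + a.left.toAdd := rfl

theorem affineHom_injective {V G : Type*} [AddCommGroup V] [Group G]
    {φ : G →* MulAut (Multiplicative V)} (hφ : Function.Injective φ) :
    Function.Injective (affineHom φ) := by
  rw [injective_iff_map_eq_one]
  intro a ha
  have h (x : V) : (φ a.right (Multiplicative.ofAdd x)).toAdd + a.left.toAdd = x := by
    rw [← affineHom_apply, ha, Equiv.Perm.one_apply]
  have hl : a.left.toAdd = 0 := by simpa using h 0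
  have hr : φ a.right = 1 := MulEquiv.ext fun x => by simpa [hl] using h x.toAdd
  exact SemidirectProduct.ext hl ((injective_iff_map_eq_one φ).mp hφ _ hr)

/-! ### The semilinear group of the tensor product -/

theorem coordAut_bijective {ι M : Type*} [Finite ι] [AddCommGroup M] [Module F M]
    (b : Module.Basis ι F M) (σ : F ≃+* F) : Function.Bijective (coordAut b σ) :=
  Function.bijective_iff_has_inverse.mpr ⟨coordAut b σ⁻¹,
    fun x => by rw [← coordAut_mul, inv_mul_cancel, coordAut_one],
    fun x => by rw [← coordAut_mul, mul_inv_cancel, coordAut_one]⟩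

theorem coordAut_basis {ι M : Type*} [Finite ι] [AddCommGroup M] [Module F M]
    (b : Module.Basis ι F M) (σ : F ≃+* F) (i : ι) : coordAut b σ (b i) = b i := by
  classical
  apply b.equivFun.injective
  ext j
  simp [coordAut, Finsupp.single_apply, apply_ite σ]

/-- The isomorphism of `GL_k(F)` with the group of linear automorphisms of a space, given by a
basis of the space. -/
noncomputable def glEquiv {k : ℕ} {M : Type*} [AddCommGroup M] [Module F M]
    (b : Module.Basis (Fin k) F M) : GL (Fin k) F ≃* (M ≃ₗ[F] M) :=
  (Units.mapEquiv (Matrix.toLinAlgEquiv b).toMulEquiv).trans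
    (LinearMap.GeneralLinearGroup.generalLinearEquiv F M)

theorem glEquiv_apply {k : ℕ} {M : Type*} [AddCommGroup M] [Module F M]
    (b : Module.Basis (Fin k) F M) (A : GL (Fin k) F) (x : M) :
    glEquiv b A x = Matrix.toLin b b A.val x := rfl

section

variable {n m : ℕ} (bU : Module.Basis (Fin n) F U) (bW : Module.Basis (Fin m) F W)

theorem matrixEnd_eq_tensorHom (a : GL (Fin n) F × GL (Fin m) F) (x : U ⊗[F] W) :
    matrixEnd bU bW a x = tensorHom F U W (glEquiv bU a.1, glEquiv bW a.2) x := rfl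

theorem semilinearAut_mk (a : GL (Fin n) F × GL (Fin m) F) (σ : F ≃+* F) (x : U ⊗[F] W) :
    (semilinearAut bU bW ⟨QuotientGroup.mk a, σ⟩ (Multiplicative.ofAdd x)).toAdd =
      matrixEnd bU bW a (tensorAut bU bW σ x) := rfl

theorem affineHom_inr_mk (a : GL (Fin n) F × GL (Fin m) F) (σ : F ≃+* F) (x : U ⊗[F] W) :
    affineHom (semilinearAut bU bW) (SemidirectProduct.inr ⟨QuotientGroup.mk a, σ⟩) x =
      matrixEnd bU bW a (tensorAut bU bW σ x) := by
  rw [affineHom_apply, SemidirectProduct.right_inr, SemidirectProduct.left_inr, semilinearAut_mk,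
    toAdd_one, add_zero]

/-- If `g ⊗ h` is the identity, then `g` and `h` are mutually inverse scalars. -/
theorem exists_scalar_of_tensorHom_eq [Nontrivial U] [Nontrivial W]
    {a : (U ≃ₗ[F] U) × (W ≃ₗ[F] W)} (ha : ∀ x, tensorHom F U W a x = x) :
    ∃ c : Fˣ, (∀ u, a.1 u = (c : F) • u) ∧ ∀ w, a.2 w = ((c⁻¹ : Fˣ) : F) • w := by
  have ha' (u : U) (w : W) : a.1 u ⊗ₜ[F] a.2 w = u ⊗ₜ w := ha (u ⊗ₜ w)
  obtain ⟨u, hu⟩ := exists_ne (0 : U)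
  obtain ⟨w, hw⟩ := exists_ne (0 : W)
  obtain ⟨f, hf⟩ := exists_functional_of_ne_zero (F := F) (u := a.2 w) (by simpa using hw)
  have h₁ (u : U) : a.1 u = f w • u := by
    simpa [hf] using congrArg (contractSnd f) (ha' u w)
  have hc : f w ≠ 0 := by
    intro h
    have := h₁ u
    rw [h, zero_smul] at this
    exact hu (by simpa using this)
  refine ⟨Units.mk0 _ hc, h₁, fun w' => ?_⟩
  have := ha' u w'
  rw [h₁, TensorProduct.smul_tmul] at this
  have hw' : f w • a.2 w' = w' := tmul_right_injective hu this
  rw [Units.val_inv_eq_inv_val, Units.val_mk0, eq_inv_smul_iff₀ hc, hw']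

theorem semilinearAut_injective [Nontrivial U] [Nontrivial W] :
    Function.Injective (semilinearAut bU bW) := by
  rw [injective_iff_map_eq_one]
  rintro ⟨q, σ⟩ h
  obtain ⟨a, rfl⟩ := QuotientGroup.mk_surjective q
  have h' (x : U ⊗[F] W) : matrixEnd bU bW a (tensorAut bU bW σ x) = x := by
    rw [← semilinearAut_mk, h]
    rfl
  obtain ⟨u, hu⟩ := exists_ne (0 : U)
  obtain ⟨w, hw⟩ := exists_ne (0 : W)
  obtain rfl : σ = 1 := by
    ext c
    have hc := h' (c • u ⊗ₜ w)
    rw [map_smulₛₗ, matrixEnd_eq_tensorHom, map_smul, ← matrixEnd_eq_tensorHom, h'] at hc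
    exact smul_left_injective F (tmul_ne_zero hu hw) hc
  simp only [tensorAut_one, matrixEnd_eq_tensorHom] at h'
  obtain ⟨c, h₁, h₂⟩ := exists_scalar_of_tensorHom_eq h'
  refine SemidirectProduct.ext ((QuotientGroup.eq_one_iff _).mpr ⟨c, Prod.ext ?_ ?_⟩) rfl
  · refine (glEquiv bU).injective (LinearEquiv.ext fun u => ?_)
    rw [h₁, glEquiv_apply, toLin_scalar]
  · refine (glEquiv bW).injective (LinearEquiv.ext fun w => ?_)
    rw [h₂, glEquiv_apply, toLin_scalar]

theorem range_affineHom_inl :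
    ((affineHom (semilinearAut bU bW)).comp SemidirectProduct.inl).range =
      translations (U ⊗[F] W) := by
  ext g
  constructor
  · rintro ⟨v, rfl⟩
    exact ⟨v.toAdd, fun x => by simp [affineHom_apply]⟩
  · rintro ⟨v, hv⟩
    exact ⟨Multiplicative.ofAdd v, Equiv.ext fun x => by simp [affineHom_apply, hv]⟩

theorem range_affineHom_inr_inl :
    (((affineHom (semilinearAut bU bW)).comp SemidirectProduct.inr).comp
      SemidirectProduct.inl).range = tensorGL F U W := by
  have key (a : GL (Fin n) F × GL (Fin m) F) (x : U ⊗[F] W) :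
      affineHom (semilinearAut bU bW) (SemidirectProduct.inr (SemidirectProduct.inl a)) x =
        tensorHom F U W (glEquiv bU a.1, glEquiv bW a.2) x := by
    refine (affineHom_inr_mk bU bW a 1 x).trans ?_
    rw [tensorAut_one, matrixEnd_eq_tensorHom]
  ext g
  constructor
  · rintro ⟨q, rfl⟩
    obtain ⟨a, rfl⟩ := QuotientGroup.mk_surjective q
    exact ⟨_, key a⟩
  · rintro ⟨a, ha⟩
    refine ⟨QuotientGroup.mk ((glEquiv bU).symm a.1, (glEquiv bW).symm a.2),
      Equiv.ext fun x => (key _ x).trans ?_⟩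
    simp [ha]

theorem range_affineHom_inr_inr :
    (((affineHom (semilinearAut bU bW)).comp SemidirectProduct.inr).comp
      SemidirectProduct.inr).range = fieldAuts bU bW := by
  have key (σ : F ≃+* F) (x : U ⊗[F] W) :
      affineHom (semilinearAut bU bW) (SemidirectProduct.inr (SemidirectProduct.inr σ)) x =
        tensorAut bU bW σ x := by
    refine (affineHom_inr_mk bU bW 1 σ x).trans ?_
    rw [map_one]
    rfl
  ext g
  constructor
  · rintro ⟨σ, rfl⟩
    exact ⟨σ, key σ⟩
  · rintro ⟨σ, hσ⟩
    exact ⟨σ, Equiv.ext fun x => (key σ x).trans (hσ x).symm⟩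

/-! ### The semilinear affine group preserves both line sets -/

theorem image_mem_linesW {g : U ⊗[F] W → U ⊗[F] W} {α : U → U} {β : W → W}
    (hα : ∀ u, u ≠ 0 → α u ≠ 0) (hβ : Function.Surjective β)
    (hg : ∀ u w v, g (u ⊗ₜ w + v) = α u ⊗ₜ β w + g v) {L : Set (U ⊗[F] W)}
    (hL : L ∈ linesW F U W) : g '' L ∈ linesW F U W := by
  obtain ⟨u, hu, v, rfl⟩ := hL
  refine ⟨α u, hα u hu, g v, ?_⟩
  ext x
  constructor
  · rintro ⟨_, ⟨w, rfl⟩, rfl⟩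
    exact ⟨β w, hg u w v⟩
  · rintro ⟨w, rfl⟩
    obtain ⟨w, rfl⟩ := hβ w
    exact ⟨_, ⟨w, rfl⟩, hg u w v⟩

theorem image_mem_linesU {g : U ⊗[F] W → U ⊗[F] W} {α : U → U} {β : W → W}
    (hα : Function.Surjective α) (hβ : ∀ w, w ≠ 0 → β w ≠ 0)
    (hg : ∀ u w v, g (u ⊗ₜ w + v) = α u ⊗ₜ β w + g v) {L : Set (U ⊗[F] W)}
    (hL : L ∈ linesU F U W) : g '' L ∈ linesU F U W := by
  obtain ⟨w, hw, v, rfl⟩ := hL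
  refine ⟨β w, hβ w hw, g v, ?_⟩
  ext x
  constructor
  · rintro ⟨_, ⟨u, rfl⟩, rfl⟩
    exact ⟨α u, hg u w v⟩
  · rintro ⟨u, rfl⟩
    obtain ⟨u, rfl⟩ := hα u
    exact ⟨_, ⟨u, rfl⟩, hg u w v⟩

theorem range_affineHom_le_autGroup {lines : Set (Set (U ⊗[F] W))}
    (hlines : lines = linesU F U W ∨ lines = linesW F U W) :
    (affineHom (semilinearAut bU bW)).range ≤ autGroup lines := by
  refine le_autGroup ?_
  rintro _ ⟨⟨t, ⟨q, σ⟩⟩, rfl⟩ L hL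
  obtain ⟨a, rfl⟩ := QuotientGroup.mk_surjective q
  have hα : Function.Bijective (glEquiv bU a.1 ∘ coordAut bU σ) :=
    (glEquiv bU a.1).bijective.comp (coordAut_bijective bU σ)
  have hβ : Function.Bijective (glEquiv bW a.2 ∘ coordAut bW σ) :=
    (glEquiv bW a.2).bijective.comp (coordAut_bijective bW σ)
  have hα₀ (u : U) (hu : u ≠ 0) : (glEquiv bU a.1 ∘ coordAut bU σ) u ≠ 0 := fun h =>
    hu (hα.injective (h.trans (by simp)))
  have hβ₀ (w : W) (hw : w ≠ 0) : (glEquiv bW a.2 ∘ coordAut bW σ) w ≠ 0 := fun h =>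
    hw (hβ.injective (h.trans (by simp)))
  have hg (u : U) (w : W) (v : U ⊗[F] W) :
      affineHom (semilinearAut bU bW) ⟨t, ⟨QuotientGroup.mk a, σ⟩⟩ (u ⊗ₜ w + v) =
        (glEquiv bU a.1 ∘ coordAut bU σ) u ⊗ₜ (glEquiv bW a.2 ∘ coordAut bW σ) w +
          affineHom (semilinearAut bU bW) ⟨t, ⟨QuotientGroup.mk a, σ⟩⟩ v := by
    simp only [affineHom_apply, semilinearAut_mk, map_add, tensorAut_tmul, matrixEnd_tmul,
      Function.comp_apply, glEquiv_apply, add_assoc]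
  rcases hlines with rfl | rfl
  · exact image_mem_linesU hα.surjective hβ₀ hg hL
  · exact image_mem_linesW hα₀ hβ.surjective hg hL

end

/-! ### The full automorphism group -/

/-- A semilinear bijection differs from the coordinatewise action of its field automorphism by a
linear one. -/
theorem exists_linearEquiv_comp_coordAut {ι : Type*} [Finite ι] (b : Module.Basis ι F W)
    {σ : F ≃+* F} {α : W ≃+ W} (hα : ∀ (c : F) w, α (c • w) = σ c • α w) :
    ∃ h : W ≃ₗ[F] W, ∀ w, α w = h (coordAut b σ w) := by
  let h : W →ₗ[F] W :=
    { toFun := fun w => α (coordAut b σ⁻¹ w)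
      map_add' := fun x y => by simp
      map_smul' := fun c x => by
        rw [map_smulₛₗ, hα]
        congr 1
        exact σ.apply_symm_apply c }
  refine ⟨LinearEquiv.ofBijective h (α.bijective.comp (coordAut_bijective b σ⁻¹)), fun w => ?_⟩
  change α w = α (coordAut b σ⁻¹ (coordAut b σ w))
  rw [← coordAut_mul, inv_mul_cancel, coordAut_one]

theorem autGroup_linesW_le [Finite F] [Nontrivial W] {m : ℕ} (bU : Module.Basis (Fin 2) F U)
    (bW : Module.Basis (Fin m) F W) :
    autGroup (linesW F U W) ≤ (affineHom (semilinearAut bU bW)).range := by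
  intro g hg
  have hrange := range_affineHom_le_autGroup bU bW (Or.inr rfl)
  -- after a translation, `g` fixes the origin
  set t : Multiplicative (U ⊗[F] W) := Multiplicative.ofAdd (g 0) with ht
  have hmem : affineHom (semilinearAut bU bW) (SemidirectProduct.inl t) ∈
      (affineHom (semilinearAut bU bW)).range := ⟨_, rfl⟩
  rw [← Subgroup.mul_mem_cancel_left _ (inv_mem hmem)]
  have hg' := mul_mem (hrange (inv_mem hmem)) hg
  set g' := (affineHom (semilinearAut bU bW) (SemidirectProduct.inl t))⁻¹ * g with hg'_def
  have hg'₀ : g' 0 = 0 := by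
    rw [hg'_def, Equiv.Perm.mul_apply, Equiv.Perm.inv_eq_iff_eq]
    simp [affineHom_apply, ht]
  obtain ⟨f, α, hα⟩ := exists_additive_coordinates bU hg' hg'₀
  obtain ⟨σ, hσ⟩ := exists_semilinear_coordinates bU f hg' hα
  obtain ⟨h, hh⟩ := exists_linearEquiv_comp_coordAut bW hσ
  refine ⟨SemidirectProduct.inr ⟨QuotientGroup.mk
    ((glEquiv bU).symm (bU.equiv f (Equiv.refl _)), (glEquiv bW).symm h), σ⟩, Equiv.ext fun x => ?_⟩
  obtain ⟨y, z, rfl⟩ := exists_tmul_add_tmul bU x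
  rw [affineHom_inr_mk, hα, hh, hh]
  simp only [map_add, tensorAut_tmul, matrixEnd_tmul, coordAut_basis, ← glEquiv_apply,
    MulEquiv.apply_symm_apply, Module.Basis.equiv_apply, Equiv.refl_apply]

theorem autGroup_eq_range_affineHom [Finite F] {m : ℕ} (hm : 2 ≤ m)
    (bU : Module.Basis (Fin 2) F U) (bW : Module.Basis (Fin m) F W)
    {lines : Set (Set (U ⊗[F] W))} (hlines : lines = linesU F U W ∨ lines = linesW F U W) :
    autGroup lines = (affineHom (semilinearAut bU bW)).range := by
  have hrank : 1 < Module.finrank F W := by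
    rw [Module.finrank_eq_card_basis bW, Fintype.card_fin]
    exact hm
  have : Nontrivial W := Module.nontrivial_of_finrank_pos (R := F) (zero_lt_one.trans hrank)
  refine le_antisymm ?_ (range_affineHom_le_autGroup bU bW hlines)
  rcases hlines with rfl | rfl
  · refine (autGroup_linesU_le fun w => ?_).trans (autGroup_linesW_le bU bW)
    by_contra! h
    exact hrank.not_ge (finrank_le_one w fun w' => Submodule.mem_span_singleton.mp (h w'))
  · exact autGroup_linesW_le bU bW

end TensorPLS

theorem proposition9p10 {F U W : Type*} [Field F] [Finite F]
    [AddCommGroup U] [Module F U] [AddCommGroup W] [Module F W]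
    (m : ℕ) (hm : 2 ≤ m)
    (bU : Module.Basis (Fin 2) F U) (bW : Module.Basis (Fin m) F W)
    (lines : Set (Set (U ⊗[F] W)))
    (hlines : lines = TensorPLS.linesU F U W ∨ lines = TensorPLS.linesW F U W) :
    TensorPLS.IsPartialLinearSpace lines ∧
    TensorPLS.IsSplitExtension (TensorPLS.tensorGL F U W ⊔ TensorPLS.fieldAuts bU bW)
      (TensorPLS.tensorGL F U W) (TensorPLS.fieldAuts bU bW) ∧
    TensorPLS.IsSplitExtension (TensorPLS.autGroup lines) (TensorPLS.translations (U ⊗[F] W))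
      (TensorPLS.tensorGL F U W ⊔ TensorPLS.fieldAuts bU bW) ∧
    Nonempty (TensorPLS.autGroup lines ≃* TensorPLS.AffineGroup bU bW) := by
  have : Nontrivial U := ⟨bU 0, 0, bU.ne_zero 0⟩
  have : Nontrivial W := ⟨bW ⟨0, by omega⟩, 0, bW.ne_zero _⟩
  have hinj := TensorPLS.affineHom_injective (TensorPLS.semilinearAut_injective bU bW)
  have hsplit := TensorPLS.isSplitExtension_range hinj
  have hsplit' := TensorPLS.isSplitExtension_range
    (f := (TensorPLS.affineHom (TensorPLS.semilinearAut bU bW)).comp SemidirectProduct.inr)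
    (hinj.comp SemidirectProduct.inr_injective)
  have hsup := hsplit'.sup_eq
  rw [TensorPLS.range_affineHom_inr_inl, TensorPLS.range_affineHom_inr_inr] at hsup hsplit'
  rw [TensorPLS.range_affineHom_inl, ← hsup] at hsplit
  rw [← hsup] at hsplit'
  have haut := TensorPLS.autGroup_eq_range_affineHom hm bU bW hlines
  refine ⟨?_, hsplit', haut ▸ hsplit, ⟨?_⟩⟩
  · rcases hlines with rfl | rfl
    · exact TensorPLS.isPartialLinearSpace_linesU
    · exact TensorPLS.isPartialLinearSpace_linesW
  · exact (MulEquiv.subgroupCongr haut).trans (MonoidHom.ofInjective hinj).symm
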